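/- **Theorem 2.16.** Let $R$ be a commutative ring with identity and let $C$ be a semidualizing $R$-module; that is, $C$ has a projective resolution by finitely generated projective modules, the homothety map $R\to\operatorname{Hom}_R(C,C)$ is an isomorphism, and $\operatorname{Ext}^i_R(C,C)=0$ for all $i\ge 1$. Let $\mathrm{Ch}(R)$ be the category of unbounded complexes of $R$-modules (with differentials lowering the degree by one), and let $\operatorname{Hom}$ denote groups of morphisms of complexes. For a class $\mathcal X$ of $R$-modules closed under isomorphism, let $\widetilde{\mathcal X}$ be the class of exact complexes all of whose cycle modules lie in $\mathcal X$. Let $\mathcal P(R)$ be the class of projective modules, $\mathcal P_C(R)$ the class of modules isomorphic to $C\otimes_R P$ with $P$ projective, and $\mathcal F_C(R)$ the class of modules isomorphic to $C\otimes_R F$ with $F$ flat. A sequence $\mathbf L$ in $\mathrm{Ch}(R)$ is called $\operatorname{Hom}(-,\widetilde{\mathcal F_C(R)})$-exact if $\operatorname{Hom}(\mathbf L,H)$ is exact for every $H\in\widetilde{\mathcal F_C(R)}$. A complex $X$ is called $D_C$-projective if there is a $\operatorname{Hom}(-,\widetilde{\mathcal F_C(R)})$-exact exact sequence in $\mathrm{Ch}(R)$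 $$\cdots\to P_1\xrightarrow{f_1}P_0\xrightarrow{f_0}Q_{-1}\xrightarrow{f_{-1}}Q_{-2}\to\cdots$$ with all $P_i\in\widetilde{\mathcal P(R)}$, all $Q_i\in\widetilde{\mathcal P_C(R)}$, and $X\cong\operatorname{Im}f_0$. Then for every $X\in\mathrm{Ch}(R)$: $X$ is $D_C$-projective if and only if there exists a $\operatorname{Hom}(-,\widetilde{\mathcal F_C(R)})$-exact exact sequence in $\mathrm{Ch}(R)$ $$\cdots\to G_1\xrightarrow{\sigma_1}G_0\xrightarrow{\sigma_0}G_{-1}\to\cdots$$ in which every $G_i$ ($i\in\mathbb Z$) is $D_C$-projective and $X\cong\operatorname{Coker}\sigma_1$. -/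

import Mathlib

open CategoryTheory
open scoped TensorProduct

universe u

namespace DingComplex

/-- A semidualizing module `C` over a commutative ring `R`. -/
structure IsSemidualizing {R : Type u} [CommRing R] (C : ModuleCat.{u} R) : Prop where
  /-- `C` has a projective resolution by finitely generated projective modules. -/
  exists_finite_resolution :
    ∃ P : ProjectiveResolution C, ∀ n : ℕ, Module.Finite R (P.complex.X n)
  /-- The homothety map `R → Hom_R(C, C)`, sending `r` to multiplication by `r`, is bijective. -/
  homothety_bijective : Function.Bijective (LinearMap.lsmul R C)
  /-- `Ext^i_R(C, C) = 0` for all `i ≥ 1`. -/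
  ext_vanishing : ∀ i : ℕ, 1 ≤ i → Subsingleton (Abelian.Ext C C i)

/-- The class of projective `R`-modules. -/
def projectiveModules (R : Type u) [CommRing R] : ObjectProperty (ModuleCat.{u} R) :=
  fun M => Module.Projective R M

/-- The class of `C`-projective modules: those isomorphic to `C ⊗ P` with `P` projective. -/
def cProjectiveModules {R : Type u} [CommRing R] (C : ModuleCat.{u} R) :
    ObjectProperty (ModuleCat.{u} R) :=
  fun M => ∃ P : ModuleCat.{u} R, Module.Projective R P ∧ Nonempty (M ≃ₗ[R] (C ⊗[R] P))

/-- The class of `C`-flat modules: those isomorphic to `C ⊗ F` with `F` flat. -/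
def cFlatModules {R : Type u} [CommRing R] (C : ModuleCat.{u} R) :
    ObjectProperty (ModuleCat.{u} R) :=
  fun M => ∃ F : ModuleCat.{u} R, Module.Flat R F ∧ Nonempty (M ≃ₗ[R] (C ⊗[R] F))

/-- The category `Ch(R)` of (unbounded, homologically graded) complexes of `R`-modules. -/
abbrev Ch (R : Type u) [CommRing R] := ChainComplex (ModuleCat.{u} R) ℤ

/-- For a class `𝒳` of modules, the class of `𝒳`-complexes: exact complexes all of whose
cycle modules belong to `𝒳`. -/
def tilde {R : Type u} [CommRing R] (𝒳 : ObjectProperty (ModuleCat.{u} R)) :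
    ObjectProperty (Ch R) :=
  fun X => X.Acyclic ∧ ∀ i : ℤ, 𝒳 (X.cycles i)

/-- A doubly infinite sequence `L` is `Hom(-, ℬ)`-exact if for every `B` in `ℬ` the sequence
`⋯ ⟶ Hom(L_{n-1}, B) ⟶ Hom(L_n, B) ⟶ Hom(L_{n+1}, B) ⟶ ⋯` is exact at every term. -/
def IsHomExact {𝒜 : Type*} [Category 𝒜] [Abelian 𝒜] (L : ChainComplex 𝒜 ℤ)
    (ℬ : ObjectProperty 𝒜) : Prop :=
  ∀ B : 𝒜, ℬ B → ∀ n : ℤ,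
    Function.Exact (fun g : L.X (n - 1) ⟶ B => L.d n (n - 1) ≫ g)
      (fun f : L.X n ⟶ B => L.d (n + 1) n ≫ f)

/-- `D_C`-projective complexes: `X ≅ Im f₀` for some exact sequence of complexes
`⋯ ⟶ E₁ ⟶ E₀ ⟶ E₋₁ ⟶ E₋₂ ⟶ ⋯` with `f₀ : E₀ ⟶ E₋₁`, which remains exact under `Hom(-, H)` for
every `C`-flat complex `H`, where `E_i` is a projective complex for `i ≥ 0` and a `C`-projective
complex for `i < 0`. -/
def IsDCProjective {R : Type u} [CommRing R] (C : ModuleCat.{u} R) (X : Ch R) : Prop :=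
  ∃ E : ChainComplex (Ch R) ℤ,
    E.Acyclic ∧ IsHomExact E (tilde (cFlatModules C)) ∧
    (∀ i : ℤ, 0 ≤ i → tilde (projectiveModules R) (E.X i)) ∧
    (∀ i : ℤ, i < 0 → tilde (cProjectiveModules C) (E.X i)) ∧
    Nonempty (X ≅ Limits.image (E.d 0 (-1)))

end DingComplex

/-! Write `ℬ` for the `C`-flat complexes and `𝒬` for the `C`-projective ones. `D_C`-projectivity is
equivalent to a one-step condition that can be iterated: `X` is left Ext-orthogonal to `ℬ` and
embeds in some `Q` in `𝒬` with a cokernel of the same kind (`coresolved`,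
`isDCProjective_iff_coresolved`). Orthogonality of the cokernels turns Hom-exactness into vanishing
of `Ext^1`, and the left half of the sequence costs nothing, because complexes in `tilde
(projectiveModules R)` are projective objects of `Ch R` and every complex is a quotient of one.

The equivalence needs `𝒬` itself to be orthogonal to `ℬ`. For modules, `Ext^i(C ⊗ P, C ⊗ F) = 0` for
`i ≥ 1` (`IsSemidualizing.leftExtOrthogonal_tensor`). Hence a `C`-projective complex splits into
disks, and Ext out of a sum of disks is controlled degreewise
(`DiskDecomposition.ext_subsingleton`).

The theorem then says that coresolving by coresolved objects gives nothing new. This is formal, from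
pushouts and closure under extensions (`coresolved_coresolved_le`). The converse direction is
witnessed by the identity of `X`, padded with zeros. -/

namespace DingComplex

open Limits Abelian

universe w w' v u'

/-! ### Short exact sequences, pushouts and coresolved objects. -/

section ShortExact

variable {𝒜 : Type u'} [Category.{v} 𝒜] [Abelian 𝒜]

/-- There is a short exact sequence `0 ⟶ A ⟶ B ⟶ D ⟶ 0`. -/
def HasSES (A B D : 𝒜) : Prop :=
  ∃ (i : A ⟶ B) (p : B ⟶ D) (w : i ≫ p = 0), (ShortComplex.mk i p w).ShortExact

lemma shortExact_of_isCokernel {A B D : 𝒜} (i : A ⟶ B) (p : B ⟶ D) (w : i ≫ p = 0)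
    [Mono i] [Epi p] (h : ∀ {T : 𝒜} (k : B ⟶ T), i ≫ k = 0 → ∃ l : D ⟶ T, p ≫ l = k) :
    (ShortComplex.mk i p w).ShortExact where
  exact := ShortComplex.exact_of_g_is_cokernel _
    (CokernelCofork.IsColimit.ofπ' p w fun k hk => ⟨(h k hk).choose, (h k hk).choose_spec⟩)

lemma ShortExact.exists_desc {A B D T : 𝒜} {i : A ⟶ B} {p : B ⟶ D} {w : i ≫ p = 0}
    (h : (ShortComplex.mk i p w).ShortExact) (k : B ⟶ T) (hk : i ≫ k = 0) :
    ∃ l : D ⟶ T, p ≫ l = k :=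
  have := h.epi_g
  ⟨h.exact.desc k hk, h.exact.g_desc k hk⟩

lemma shortExact_pushout {A B D G : 𝒜} {i : A ⟶ B} {p : B ⟶ D} {w : i ≫ p = 0}
    (h : (ShortComplex.mk i p w).ShortExact) (j : A ⟶ G) :
    ∃ (q : pushout j i ⟶ D) (w' : pushout.inl j i ≫ q = 0),
      (ShortComplex.mk (pushout.inl j i) q w').ShortExact := by
  have : Mono i := h.mono_f
  have : Epi p := h.epi_g
  have hw : j ≫ (0 : G ⟶ D) = i ≫ p := by rw [w, comp_zero]
  have : Epi (pushout.desc 0 p hw) := epi_of_epi_fac (pushout.inr_desc 0 p hw)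
  refine ⟨pushout.desc 0 p hw, pushout.inl_desc _ _ _,
    shortExact_of_isCokernel _ _ _ fun k hk => ?_⟩
  obtain ⟨l, hl⟩ := ShortExact.exists_desc h (pushout.inr j i ≫ k) (by
    rw [← pushout.condition_assoc, hk, comp_zero])
  refine ⟨l, pushout.hom_ext ?_ ?_⟩
  · rw [pushout.inl_desc_assoc, zero_comp, hk]
  · rw [pushout.inr_desc_assoc, hl]

lemma HasSES.of_iso {A B D A' B' D' : 𝒜} (h : HasSES A B D) (a : A ≅ A') (b : B ≅ B')
    (d : D ≅ D') : HasSES A' B' D' := by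
  obtain ⟨i, p, w, h⟩ := h
  exact ⟨a.inv ≫ i ≫ b.hom, b.inv ≫ p ≫ d.hom, by simp [reassoc_of% w],
    ShortComplex.shortExact_of_iso (ShortComplex.isoMk a b d) h⟩

/-- `W` is the pushout of `B` and `G` under `A`; pushing out a monomorphism leaves its cokernel
unchanged, along either leg. -/
lemma HasSES.exists_pushout {A B D G K : 𝒜} (h₁ : HasSES A B D) (h₂ : HasSES A G K) :
    ∃ W, HasSES G W D ∧ HasSES B W K := by
  obtain ⟨i, p, w, h⟩ := h₁
  obtain ⟨j, q, w', h'⟩ := h₂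
  obtain ⟨_, _, hw₁⟩ := shortExact_pushout h j
  obtain ⟨_, _, hw₂⟩ := shortExact_pushout h' i
  exact ⟨pushout j i, ⟨_, _, _, hw₁⟩,
    HasSES.of_iso ⟨_, _, _, hw₂⟩ (Iso.refl _) (pushoutSymmetry i j) (Iso.refl _)⟩

/-- Third isomorphism theorem for `Y ⊆ W ⊆ Q`: the quotient `Q/Y` is obtained as the pushout of `Q`
along `W ⟶ W/Y`. -/
lemma HasSES.exists_quotient {Y W K Q W' : 𝒜} (h₁ : HasSES Y W K) (h₂ : HasSES W Q W') :
    ∃ Y', HasSES Y Q Y' ∧ HasSES K Y' W' := by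
  obtain ⟨f, g, w, h⟩ := h₁
  obtain ⟨i, p, w', h'⟩ := h₂
  obtain ⟨_, _, hw₁⟩ := shortExact_pushout h' g
  have := h.mono_f
  have := h.epi_g
  have := h'.mono_f
  dsimp at *
  refine ⟨pushout g i, ⟨f ≫ i, pushout.inr g i, ?_, shortExact_of_isCokernel _ _ _ ?_⟩,
    ⟨_, _, _, hw₁⟩⟩
  · rw [Category.assoc, ← pushout.condition, reassoc_of% w, zero_comp]
  · intro T k hk
    obtain ⟨l, hl⟩ := ShortExact.exists_desc h (i ≫ k) (by simpa using hk)
    exact ⟨pushout.desc l k hl, pushout.inr_desc _ _ _⟩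

lemma HasSES.of_isZero_left {Z : 𝒜} (hZ : IsZero Z) (X : 𝒜) : HasSES Z X X :=
  have : Mono (0 : Z ⟶ X) := ⟨fun _ _ _ => hZ.eq_of_tgt _ _⟩
  ⟨0, 𝟙 X, by simp, shortExact_of_isCokernel _ _ _ fun k _ => ⟨k, by simp⟩⟩

lemma HasSES.of_isZero_right {Z : 𝒜} (hZ : IsZero Z) (X : 𝒜) : HasSES X X Z :=
  have : Epi (0 : X ⟶ Z) := ⟨fun _ _ _ => hZ.eq_of_src _ _⟩
  ⟨𝟙 X, 0, by simp, shortExact_of_isCokernel _ _ _ fun k hk => ⟨0, by simpa using hk.symm⟩⟩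

lemma HasSES.of_epi {A B : 𝒜} (p : A ⟶ B) [Epi p] : HasSES (kernel p) A B :=
  ⟨kernel.ι p, p, by simp,
    { exact := ShortComplex.exact_of_f_is_kernel _ (kernelIsKernel p) }⟩

lemma HasSES.biprod_left (A : 𝒜) {D Q D' : 𝒜} (h : HasSES D Q D') :
    HasSES (A ⊞ D) (A ⊞ Q) D' := by
  obtain ⟨i, p, w, h⟩ := h
  have := h.mono_f
  have := h.epi_g
  dsimp at *
  have : Mono (biprod.map (𝟙 A) i) := by infer_instance
  refine ⟨biprod.map (𝟙 A) i, biprod.snd ≫ p, by simp [w],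
    shortExact_of_isCokernel _ _ _ fun k hk => ?_⟩
  obtain ⟨l, hl⟩ := ShortExact.exists_desc h (biprod.inr ≫ k) (by
    have := biprod.inr ≫= hk
    simpa using this)
  refine ⟨l, biprod.hom_ext' _ _ ?_ (by simp [hl])⟩
  have := biprod.inl ≫= hk
  simp at this
  simp [this]

/-- The largest class `𝒮 ⊆ 𝒱` such that every `X` in `𝒮` sits in a short exact sequence
`0 ⟶ X ⟶ Q ⟶ Y ⟶ 0` with `Q` in `𝒬` and `Y` in `𝒮`. -/
def coresolved (𝒱 𝒬 : ObjectProperty 𝒜) : ObjectProperty 𝒜 := fun X =>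
  ∃ 𝒮 : ObjectProperty 𝒜, 𝒮 X ∧
    ∀ X, 𝒮 X → 𝒱 X ∧ ∃ Q Y, 𝒬 Q ∧ 𝒮 Y ∧ HasSES X Q Y

variable {𝒱 𝒬 : ObjectProperty 𝒜}

lemma coresolved.mem {X : 𝒜} (h : coresolved 𝒱 𝒬 X) : 𝒱 X :=
  let ⟨_, hX, h⟩ := h; (h X hX).1

/-- The class is a greatest fixed point: this unfolds it once, while membership is proved by
exhibiting any class stable under the one-step condition. -/
lemma coresolved.exists_hasSES {X : 𝒜} (h : coresolved 𝒱 𝒬 X) :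
    ∃ Q Y, 𝒬 Q ∧ coresolved 𝒱 𝒬 Y ∧ HasSES X Q Y :=
  let ⟨𝒮, hX, h⟩ := h
  let ⟨Q, Y, hQ, hY, e⟩ := (h X hX).2
  ⟨Q, Y, hQ, ⟨𝒮, hY, h⟩, e⟩

end ShortExact

/-! ### Ext-orthogonality and stability of coresolved objects. -/

section Ext

variable {𝒜 : Type u'} [Category.{v} 𝒜] [Abelian 𝒜] [HasExt.{w} 𝒜]

/-- The class of objects `X` such that `Ext^i(X, B) = 0` for all `i ≥ 1` and all `B` in `ℬ`. -/
def leftExtOrthogonal (ℬ : ObjectProperty 𝒜) : ObjectProperty 𝒜 :=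
  fun X => ∀ B, ℬ B → ∀ i : ℕ, Subsingleton (Ext X B (i + 1))

/-- The connecting map `Hom(A, H) → Ext^1(D, H)` is onto, and it kills every map that extends to
`B`. -/
lemma ext_one_subsingleton_of_extend {A B D H : 𝒜} {i : A ⟶ B} {p : B ⟶ D} {w : i ≫ p = 0}
    (h : (ShortComplex.mk i p w).ShortExact) (hB : Subsingleton (Ext B H 1))
    (hext : ∀ f : A ⟶ H, ∃ g : B ⟶ H, i ≫ g = f) : Subsingleton (Ext D H 1) := by
  refine subsingleton_of_forall_eq 0 fun x => ?_
  obtain ⟨y, rfl⟩ := Ext.contravariant_sequence_exact₃ h H x (Subsingleton.elim _ _)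
    (n₀ := 0) rfl
  obtain ⟨f, rfl⟩ := Ext.addEquiv₀.symm.surjective y
  obtain ⟨g, rfl⟩ := hext f
  rw [Ext.addEquiv₀_symm_apply, ← Ext.mk₀_comp_mk₀, h.extClass_comp_assoc]

lemma exists_extend_of_ext_one_subsingleton {A B D H : 𝒜} {i : A ⟶ B} {p : B ⟶ D}
    {w : i ≫ p = 0} (h : (ShortComplex.mk i p w).ShortExact) (hD : Subsingleton (Ext D H 1))
    (f : A ⟶ H) : ∃ g : B ⟶ H, i ≫ g = f := by
  obtain ⟨x, hx⟩ := Ext.contravariant_sequence_exact₁ h H (Ext.mk₀ f) (n₁ := 1) rfl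
    (Subsingleton.elim _ _)
  obtain ⟨g, rfl⟩ := Ext.addEquiv₀.symm.surjective x
  refine ⟨g, Ext.addEquiv₀.symm.injective ?_⟩
  simpa using hx

lemma HasSES.ext_left {A B D H : 𝒜} (h : HasSES A B D) (n : ℕ)
    (hB : Subsingleton (Ext B H n)) (hD : Subsingleton (Ext D H (n + 1))) :
    Subsingleton (Ext A H n) := by
  obtain ⟨i, p, w, h⟩ := h
  refine subsingleton_of_forall_eq 0 fun x => ?_
  obtain ⟨y, rfl⟩ := Ext.contravariant_sequence_exact₁ h H x (add_comm 1 n)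
    (Subsingleton.elim _ _)
  rw [Subsingleton.elim y 0, Ext.comp_zero]

lemma HasSES.ext_middle {A B D H : 𝒜} (h : HasSES A B D) (n : ℕ)
    (hA : Subsingleton (Ext A H n)) (hD : Subsingleton (Ext D H n)) :
    Subsingleton (Ext B H n) := by
  obtain ⟨i, p, w, h⟩ := h
  refine subsingleton_of_forall_eq 0 fun x => ?_
  obtain ⟨y, rfl⟩ := Ext.contravariant_sequence_exact₂ h H x (Subsingleton.elim _ _)
  rw [Subsingleton.elim y 0, Ext.comp_zero]

lemma HasSES.ext_right {A B D H : 𝒜} (h : HasSES A B D) (n : ℕ)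
    (hA : Subsingleton (Ext A H n)) (hB : Subsingleton (Ext B H (n + 1))) :
    Subsingleton (Ext D H (n + 1)) := by
  obtain ⟨i, p, w, h⟩ := h
  refine subsingleton_of_forall_eq 0 fun x => ?_
  obtain ⟨y, rfl⟩ := Ext.contravariant_sequence_exact₃ h H x (Subsingleton.elim _ _)
    (add_comm 1 n)
  rw [Subsingleton.elim y 0, Ext.comp_zero]

lemma HasSES.ext_target {A B D X : 𝒜} (h : HasSES A B D) (n : ℕ)
    (hA : Subsingleton (Ext X A n)) (hD : Subsingleton (Ext X D n)) :
    Subsingleton (Ext X B n) := by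
  obtain ⟨i, p, w, h⟩ := h
  refine subsingleton_of_forall_eq 0 fun x => ?_
  obtain ⟨y, rfl⟩ := Ext.covariant_sequence_exact₂ _ h x (Subsingleton.elim _ _)
  rw [Subsingleton.elim y 0, Ext.zero_comp]

variable {ℬ : ObjectProperty 𝒜}

lemma leftExtOrthogonal_of_projective (P : 𝒜) [Projective P] : leftExtOrthogonal ℬ P :=
  fun _ _ _ => Ext.subsingleton_of_projective _ _ _

lemma leftExtOrthogonal_of_isZero {Z : 𝒜} (hZ : IsZero Z) : leftExtOrthogonal ℬ Z :=
  have : Projective Z := ⟨fun _ _ _ => ⟨0, hZ.eq_of_src _ _⟩⟩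
  leftExtOrthogonal_of_projective Z

lemma leftExtOrthogonal_of_iso {X Y : 𝒜} (e : X ≅ Y) (hX : leftExtOrthogonal ℬ X) :
    leftExtOrthogonal ℬ Y :=
  fun B hB i => ((HasSES.of_isZero_left (isZero_zero 𝒜) X).of_iso (Iso.refl _) e
    (Iso.refl _)).ext_middle (i + 1)
      (leftExtOrthogonal_of_isZero (isZero_zero 𝒜) B hB i) (hX B hB i)

lemma HasSES.leftExtOrthogonal_left {A B D : 𝒜} (h : HasSES A B D)
    (hB : leftExtOrthogonal ℬ B) (hD : leftExtOrthogonal ℬ D) : leftExtOrthogonal ℬ A :=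
  fun H hH n => h.ext_left (n + 1) (hB H hH n) (hD H hH (n + 1))

lemma HasSES.leftExtOrthogonal_middle {A B D : 𝒜} (h : HasSES A B D)
    (hA : leftExtOrthogonal ℬ A) (hD : leftExtOrthogonal ℬ D) : leftExtOrthogonal ℬ B :=
  fun H hH n => h.ext_middle (n + 1) (hA H hH n) (hD H hH n)

/-- Dimension shifting along a family of short exact sequences `0 ⟶ Z' ⟶ E ⟶ Z ⟶ 0`. -/
lemma leftExtOrthogonal_of_syzygies {ι : Type*} (Z E : ι → 𝒜) (s : ι → ι)
    (i : ∀ n, Z (s n) ⟶ E n) (p : ∀ n, E n ⟶ Z n) (w : ∀ n, i n ≫ p n = 0)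
    (h : ∀ n, (ShortComplex.mk (i n) (p n) (w n)).ShortExact)
    (hE : ∀ n, leftExtOrthogonal ℬ (E n))
    (hext : ∀ n H, ℬ H → ∀ f : Z (s n) ⟶ H, ∃ g : E n ⟶ H, i n ≫ g = f) (n : ι) :
    leftExtOrthogonal ℬ (Z n) := by
  intro H hH k
  induction k generalizing n with
  | zero => exact ext_one_subsingleton_of_extend (h n) (hE n H hH 0) (hext n H hH)
  | succ k ih => exact HasSES.ext_right ⟨_, _, _, h n⟩ (k + 1) (ih _) (hE n H hH (k + 1))

variable {𝒬 : ObjectProperty 𝒜}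

lemma coresolved_of_isZero (h𝒬 : ∀ Z : 𝒜, IsZero Z → 𝒬 Z) {Z : 𝒜} (hZ : IsZero Z) :
    coresolved (leftExtOrthogonal ℬ) 𝒬 Z :=
  ⟨fun X => IsZero X, hZ, fun X hX => ⟨leftExtOrthogonal_of_isZero hX,
    X, X, h𝒬 X hX, hX, HasSES.of_isZero_left hX X⟩⟩

/-- A horseshoe argument. Pushing out along `A ⟶ QA` gives an extension of `D` by `QA`, which splits
since `Ext^1(D, QA) = 0`. So `B` embeds in `QA ⊞ D`, hence in `QA ⊞ QD`, and the cokernel is an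
extension of `D'` by `A'`. -/
lemma coresolved_extension (h𝒬ℬ : 𝒬 ≤ ℬ) (hsum : ∀ Q Q', 𝒬 Q → 𝒬 Q' → 𝒬 (Q ⊞ Q'))
    {A B D : 𝒜} (h : HasSES A B D) (hA : coresolved (leftExtOrthogonal ℬ) 𝒬 A)
    (hD : coresolved (leftExtOrthogonal ℬ) 𝒬 D) :
    coresolved (leftExtOrthogonal ℬ) 𝒬 B := by
  refine ⟨fun B => ∃ A D, HasSES A B D ∧ coresolved (leftExtOrthogonal ℬ) 𝒬 A ∧
    coresolved (leftExtOrthogonal ℬ) 𝒬 D, ⟨A, D, h, hA, hD⟩, ?_⟩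
  rintro B ⟨A, D, h, hA, hD⟩
  refine ⟨h.leftExtOrthogonal_middle hA.mem hD.mem, ?_⟩
  obtain ⟨QA, A', hQA, hA', sA⟩ := hA.exists_hasSES
  obtain ⟨QD, D', hQD, hD', sD⟩ := hD.exists_hasSES
  obtain ⟨B₁, h₁, h₂⟩ := h.exists_pushout sA
  obtain ⟨i, p, w, h₁⟩ := h₁
  obtain ⟨r, hr⟩ := exists_extend_of_ext_one_subsingleton h₁ (hD.mem _ (h𝒬ℬ _ hQA) 0) (𝟙 QA)
  have := h₁.epi_g
  have e : B₁ ≅ QA ⊞ D :=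
    (ShortComplex.Splitting.ofExactOfRetraction _ h₁.exact r hr h₁.epi_g).isoBinaryBiproduct
  obtain ⟨B', h₃, h₄⟩ := (h₂.of_iso (Iso.refl _) e (Iso.refl _)).exists_quotient
    (sD.biprod_left QA)
  exact ⟨_, B', hsum _ _ hQA hQD, ⟨A', D', h₄, hA', hD'⟩, h₃⟩

/-- The stable class consists of extensions `Y` of a coresolved `G'` by a doubly coresolved `K`.
With `K ⊆ G` and `G/K = K'`, the pushout `W` is an extension of `G'` by `G`, hence coresolved and
contained in some `Q` with coresolved quotient `W'`. Then `Q/Y` is an extension of `W'` by `W/Y =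
K'`, which is again in the class. -/
theorem coresolved_coresolved_le (h𝒬ℬ : 𝒬 ≤ ℬ) (h0 : ∀ Z : 𝒜, IsZero Z → 𝒬 Z)
    (hsum : ∀ Q Q', 𝒬 Q → 𝒬 Q' → 𝒬 (Q ⊞ Q')) :
    coresolved (leftExtOrthogonal ℬ) (coresolved (leftExtOrthogonal ℬ) 𝒬) ≤
      coresolved (leftExtOrthogonal ℬ) 𝒬 := by
  intro X hX
  refine ⟨fun Y => ∃ K G, HasSES K Y G ∧
    coresolved (leftExtOrthogonal ℬ) (coresolved (leftExtOrthogonal ℬ) 𝒬) K ∧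
    coresolved (leftExtOrthogonal ℬ) 𝒬 G,
    ⟨X, _, HasSES.of_isZero_right (isZero_zero _) X, hX,
      coresolved_of_isZero h0 (isZero_zero _)⟩, ?_⟩
  rintro Y ⟨K, G', h, hK, hG'⟩
  refine ⟨h.leftExtOrthogonal_middle hK.mem hG'.mem, ?_⟩
  obtain ⟨G, K', hG, hK', s⟩ := hK.exists_hasSES
  obtain ⟨W, h₁, h₂⟩ := h.exists_pushout s
  obtain ⟨Q, W', hQ, hW', s'⟩ := (coresolved_extension h𝒬ℬ hsum h₁ hG hG').exists_hasSES
  obtain ⟨Y', h₃, h₄⟩ := h₂.exists_quotient s'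
  exact ⟨Q, Y', hQ, ⟨K', W', h₄, hK', hW'⟩, h₃⟩

end Ext

/-! ### Splicing short exact sequences into complexes and cutting them back. -/

section Splice

variable {𝒜 : Type u'} [Category.{v} 𝒜] [Abelian 𝒜]

/-- The homology at `i` is the kernel of `fromOpcycles`, so exactness at `i` alone suffices.
Opcycles are used throughout because they are the cokernels of the differentials, as in the second
description of `X`. -/
lemma shortExact_opcycles {κ : Type*} {c : ComplexShape κ} (K : HomologicalComplex 𝒜 c)
    {i j : κ} (hij : c.Rel i j) (hK : K.ExactAt i) :
    (ShortComplex.mk (K.fromOpcycles i j) (K.pOpcycles j) (by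
      rw [← cancel_epi (K.pOpcycles i), K.p_fromOpcycles_assoc, K.d_pOpcycles,
        comp_zero])).ShortExact := by
  have : Mono (K.fromOpcycles i j) :=
    Preadditive.mono_of_isZero_kernel' _ (K.homologyIsKernel i j (c.next_eq' hij))
      hK.isZero_homology
  refine shortExact_of_isCokernel _ _ _ fun k hk =>
    ⟨K.descOpcycles k i (c.prev_eq' hij) ?_, K.p_descOpcycles _ _ _ _⟩
  rw [← K.p_fromOpcycles, Category.assoc, hk, comp_zero]

section

variable {K : ChainComplex 𝒜 ℤ} {Z : ℤ → 𝒜} {i : ∀ n, Z (n + 1) ⟶ K.X n}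
  {p : ∀ n, K.X n ⟶ Z n} {w : ∀ n, i n ≫ p n = 0}
  (h : ∀ n, (ShortComplex.mk (i n) (p n) (w n)).ShortExact)
  (hd : ∀ n, K.d (n + 1) n = p (n + 1) ≫ i n)

include h hd

lemma acyclic_of_splicing : K.Acyclic := by
  intro m
  obtain ⟨n, rfl⟩ : ∃ n, m = n + 1 := ⟨m - 1, by ring⟩
  rw [HomologicalComplex.exactAt_iff' _ (n + 1 + 1) (n + 1) n (by simp) (by simp)]
  have : Epi (p (n + 1 + 1)) := (h (n + 1 + 1)).epi_g
  have : Mono (i n) := (h n).mono_f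
  let φ : ShortComplex.mk (p (n + 1 + 1) ≫ i (n + 1)) (p (n + 1)) (by simp [w]) ⟶
      ShortComplex.mk (i (n + 1)) (p (n + 1)) (w (n + 1)) :=
    { τ₁ := p (n + 1 + 1), τ₂ := 𝟙 _, τ₃ := 𝟙 _ }
  let ψ : ShortComplex.mk (p (n + 1 + 1) ≫ i (n + 1)) (p (n + 1)) (by simp [w]) ⟶
      K.sc' (n + 1 + 1) (n + 1) n :=
    { τ₁ := 𝟙 _, τ₂ := 𝟙 _, τ₃ := i n
      comm₁₂ := (Category.id_comp _).trans ((hd (n + 1)).trans (Category.comp_id _).symm)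
      comm₂₃ := (Category.id_comp _).trans (hd n) }
  have : Epi φ.τ₁ := ‹_›
  have : IsIso φ.τ₂ := inferInstanceAs (IsIso (𝟙 _))
  have : Mono φ.τ₃ := inferInstanceAs (Mono (𝟙 _))
  have : Epi ψ.τ₁ := inferInstanceAs (Epi (𝟙 _))
  have : IsIso ψ.τ₂ := inferInstanceAs (IsIso (𝟙 _))
  have : Mono ψ.τ₃ := ‹_›
  rw [← ShortComplex.exact_iff_of_epi_of_isIso_of_mono ψ,
    ShortComplex.exact_iff_of_epi_of_isIso_of_mono φ]
  exact (h (n + 1)).exact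

/-- The opcycles of a spliced complex. -/
noncomputable def opcyclesIsoOfSplicing (n : ℤ) : K.opcycles n ≅ Z n :=
  have : Epi (p n) := (h n).epi_g
  have : Epi (p (n + 1)) := (h (n + 1)).epi_g
  have hw : K.d (n + 1) n ≫ p n = 0 := by rw [hd, Category.assoc, w, comp_zero]
  have hc : ∀ {T : 𝒜} (k : K.X n ⟶ T), K.d (n + 1) n ≫ k = 0 → ∃ l, p n ≫ l = k :=
    fun k hk => ShortExact.exists_desc (h n) k (by
      rwa [hd, Category.assoc, ← comp_zero (X := K.X (n + 1)) (f := p (n + 1)),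
        cancel_epi] at hk)
  (K.opcyclesIsCokernel (n + 1) n (by simp)).coconePointUniqueUpToIso
    (CokernelCofork.IsColimit.ofπ' (p n) hw fun k hk =>
      ⟨(hc k hk).choose, (hc k hk).choose_spec⟩)

end

/-- A map killed by the incoming differential is a map out of the opcycles, so Hom-exactness is an
extension property along `opcycles (n + 1) ⟶ K.X n`. -/
lemma isHomExact_iff (K : ChainComplex 𝒜 ℤ) (ℬ : ObjectProperty 𝒜) :
    IsHomExact K ℬ ↔ ∀ B, ℬ B → ∀ (n : ℤ) (f : K.opcycles (n + 1) ⟶ B),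
      ∃ g : K.X n ⟶ B, K.fromOpcycles (n + 1) n ≫ g = f := by
  have key : IsHomExact K ℬ ↔ ∀ B, ℬ B → ∀ (n : ℤ) (f : K.X (n + 1) ⟶ B),
      K.d (n + 1 + 1) (n + 1) ≫ f = 0 → ∃ g : K.X n ⟶ B, K.d (n + 1) n ≫ g = f := by
    -- Keeping `m` free avoids rewriting `n + 1 - 1` inside the types of the differentials.
    have aux : ∀ B (n m : ℤ), n + 1 = m →
        (Function.Exact (fun g : K.X (m - 1) ⟶ B => K.d m (m - 1) ≫ g)
          (fun f : K.X m ⟶ B => K.d (m + 1) m ≫ f) ↔ ∀ (f : K.X m ⟶ B),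
      K.d (m + 1) m ≫ f = 0 → ∃ g : K.X n ⟶ B, K.d m n ≫ g = f) := by
      intro B n m h
      obtain rfl : n = m - 1 := by lia
      refine ⟨fun H f hf => (H f).1 hf, fun H f => ⟨fun hf => H f hf, ?_⟩⟩
      rintro ⟨g, rfl⟩
      simp
    constructor
    · intro H B hB n
      exact (aux B n (n + 1) rfl).1 (H B hB (n + 1))
    · intro H B hB m
      refine (aux B (m - 1) m (by ring)).2 ?_
      obtain ⟨n, rfl⟩ : ∃ n, m = n + 1 := ⟨m - 1, by ring⟩
      have : n + 1 - 1 = n := by ring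
      rw [this]
      exact H B hB n
  rw [key]
  refine forall₃_congr fun B _ n => ⟨fun H f => ?_, fun H f hf => ?_⟩
  · obtain ⟨g, hg⟩ := H (K.pOpcycles (n + 1) ≫ f) (by simp)
    refine ⟨g, ?_⟩
    rw [← cancel_epi (K.pOpcycles (n + 1)), K.p_fromOpcycles_assoc, hg]
  · obtain ⟨g, hg⟩ := H (K.descOpcycles f (n + 1 + 1) (by simp) hf)
    exact ⟨g, by rw [← K.p_fromOpcycles, Category.assoc, hg, K.p_descOpcycles]⟩

/-- For an acyclic complex, the opcycles are the images of the differentials. -/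
noncomputable def opcyclesIsoImage (K : ChainComplex 𝒜 ℤ) (hK : K.Acyclic) {i j : ℤ}
    (hij : j + 1 = i) : K.opcycles i ≅ image (K.d i j) :=
  have := (shortExact_opcycles K (c := ComplexShape.down ℤ) hij (hK i)).mono_f
  have := strongEpi_of_epi (K.pOpcycles i)
  image.isoStrongEpiMono (K.pOpcycles i) (K.fromOpcycles i j) (K.p_fromOpcycles i j)

/-- Opcycles are the cokernels of the differentials. -/
noncomputable def opcyclesIsoCokernel (K : ChainComplex 𝒜 ℤ) {i j : ℤ} (hij : j + 1 = i) :
    K.opcycles j ≅ cokernel (K.d i j) :=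
  (K.opcyclesIsCokernel i j (by simpa using hij)).coconePointUniqueUpToIso
    (colimit.isColimit (parallelPair (K.d i j) 0))

variable [HasExt.{w} 𝒜]

/-- Hom-exactness starts a dimension shift which makes all opcycles orthogonal to `ℬ`; those in
degrees `n ≤ 0` then form a stable class, which uses `𝒬` only in negative degrees. -/
lemma coresolved_of_acyclic {ℬ 𝒬 : ObjectProperty 𝒜} (K : ChainComplex 𝒜 ℤ)
    (hK : K.Acyclic) (hHom : IsHomExact K ℬ) (hV : ∀ n, leftExtOrthogonal ℬ (K.X n))
    (h𝒬 : ∀ n < 0, 𝒬 (K.X n)) {X : 𝒜} (e : X ≅ K.opcycles 0) :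
    coresolved (leftExtOrthogonal ℬ) 𝒬 X := by
  have hs (n : ℤ) := shortExact_opcycles K (c := ComplexShape.down ℤ) (i := n + 1) (j := n)
    rfl (hK (n + 1))
  have hZ : ∀ n, leftExtOrthogonal ℬ (K.opcycles n) :=
    leftExtOrthogonal_of_syzygies (fun n => K.opcycles n) K.X (fun n => n + 1)
      (fun n => K.fromOpcycles (n + 1) n) (fun n => K.pOpcycles n) _ hs hV
      fun n H hH f => (isHomExact_iff K ℬ).1 hHom H hH n f
  refine ⟨fun Y => ∃ n ≤ 0, Nonempty (K.opcycles n ≅ Y), ⟨0, le_rfl, ⟨e.symm⟩⟩, ?_⟩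
  rintro Y ⟨m, hm, ⟨e⟩⟩
  obtain ⟨n, rfl⟩ : ∃ n, m = n + 1 := ⟨m - 1, by ring⟩
  have hY : HasSES Y (K.X n) (K.opcycles n) :=
    HasSES.of_iso ⟨_, _, _, hs n⟩ e (Iso.refl _) (Iso.refl _)
  exact ⟨hY.leftExtOrthogonal_left (hV n) (hZ n), K.X n, K.opcycles n, h𝒬 n (by lia),
    ⟨n, by lia, ⟨Iso.refl _⟩⟩, hY⟩

/-- Hom-exactness of the spliced complex comes from `Ext^1(Z n, B) = 0`. -/
lemma exists_complex_of_hasSES {ℬ : ObjectProperty 𝒜} (Z E : ℤ → 𝒜)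
    (h : ∀ n, HasSES (Z (n + 1)) (E n) (Z n)) (hZ : ∀ n, leftExtOrthogonal ℬ (Z n)) :
    ∃ K : ChainComplex 𝒜 ℤ, K.Acyclic ∧ IsHomExact K ℬ ∧ K.X = E ∧
      Nonempty (Z 0 ≅ K.opcycles 0) := by
  obtain ⟨K, hE, i, p, w, h, hd⟩ : ∃ (K : ChainComplex 𝒜 ℤ) (_ : K.X = E)
      (i : ∀ n, Z (n + 1) ⟶ K.X n) (p : ∀ n, K.X n ⟶ Z n) (w : ∀ n, i n ≫ p n = 0),
      (∀ n, (ShortComplex.mk (i n) (p n) (w n)).ShortExact) ∧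
      ∀ n, K.d (n + 1) n = p (n + 1) ≫ i n := by
    choose i p w h using h
    exact ⟨ChainComplex.of E (fun n => p (n + 1) ≫ i n) fun n => by simp [reassoc_of% w],
      rfl, i, p, w, h, fun n =>
        ChainComplex.of_d E (fun n => p (n + 1) ≫ i n) n⟩
  have hK := acyclic_of_splicing h hd
  have hs (n : ℤ) := shortExact_opcycles K (c := ComplexShape.down ℤ)
    (i := n + 1) (j := n) rfl (hK (n + 1))
  refine ⟨K, hK, ?_, hE, ⟨(opcyclesIsoOfSplicing h hd 0).symm⟩⟩
  rw [isHomExact_iff]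
  intro B hB n f
  have e := opcyclesIsoOfSplicing h hd n
  refine exists_extend_of_ext_one_subsingleton (hs n) ?_ f
  exact leftExtOrthogonal_of_iso e.symm (hZ n) B hB 0

lemma exists_iterate {α β : Type*} {p : α → Prop} {r : α → β → α → Prop}
    (h : ∀ a, p a → ∃ b a', p a' ∧ r a b a') {a : α} (ha : p a) :
    ∃ (x : ℕ → α) (y : ℕ → β), x 0 = a ∧ (∀ n, p (x n)) ∧ ∀ n, r (x n) (y n) (x (n + 1)) := by
  choose f g hg hr using h
  let f' : {a // p a} → {a // p a} := fun a => ⟨g a a.2, hg a a.2⟩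
  let x : ℕ → {a // p a} := fun n => f'^[n] ⟨a, ha⟩
  refine ⟨fun n => x n, fun n => f (x n) (x n).2, rfl, fun n => (x n).2, fun n => ?_⟩
  have : x (n + 1) = f' (x n) := Function.iterate_succ_apply' _ _ _
  simp only [this]
  exact hr _ _

theorem exists_complex_of_coresolved {ℬ 𝒯 𝒬 : ObjectProperty 𝒜}
    (h𝒯 : 𝒯 ≤ leftExtOrthogonal ℬ) (enough : ∀ X : 𝒜, ∃ P K, 𝒯 P ∧ HasSES K P X)
    {X : 𝒜} (hX : coresolved (leftExtOrthogonal ℬ) 𝒬 X) :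
    ∃ E : ChainComplex 𝒜 ℤ, E.Acyclic ∧ IsHomExact E ℬ ∧ (∀ n, 0 ≤ n → 𝒯 (E.X n)) ∧
      (∀ n < 0, 𝒬 (E.X n)) ∧ Nonempty (X ≅ E.opcycles 0) := by
  obtain ⟨l, P, hl0, hl, hP⟩ := exists_iterate (p := leftExtOrthogonal ℬ)
    (r := fun X P K => 𝒯 P ∧ HasSES K P X) (fun X hX => by
      obtain ⟨P, K, hP, h⟩ := enough X
      exact ⟨P, K, h.leftExtOrthogonal_left (h𝒯 _ hP) hX, hP, h⟩) hX.mem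
  obtain ⟨r, Q, hr0, hr, hQ⟩ := exists_iterate (p := coresolved (leftExtOrthogonal ℬ) 𝒬)
    (r := fun X Q Y => 𝒬 Q ∧ HasSES X Q Y) (fun X hX => by
      obtain ⟨Q, Y, hQ, hY, h⟩ := hX.exists_hasSES
      exact ⟨Q, Y, hY, hQ, h⟩) hX
  -- `negSucc k` is degree `-(k + 1)`, whence the shift in `r (k + 1)`. The two halves meet at `l 0
  -- = X = r 0`.
  let Z : ℤ → 𝒜 := fun n => match n with
    | .ofNat k => l k
    | .negSucc k => r (k + 1)
  let E : ℤ → 𝒜 := fun n => match n with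
    | .ofNat k => P k
    | .negSucc k => Q k
  obtain ⟨K, hK, hHom, hE, e⟩ := exists_complex_of_hasSES (ℬ := ℬ) Z E (fun n => match n with
    | .ofNat k => (hP k).2
    | .negSucc 0 => by
      have := (hQ 0).2
      rw [hr0, ← hl0] at this
      exact this
    | .negSucc (k + 1) => (hQ (k + 1)).2) (fun n => match n with
    | .ofNat k => hl k
    | .negSucc k => (hr (k + 1)).mem)
  refine ⟨K, hK, hHom, ?_, ?_, ?_⟩
  · rintro (k | k) hk
    · rw [hE]; exact (hP k).1
    · exact absurd hk (by lia)
  · rintro (k | k) hk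
    · exact absurd hk (by simp)
    · rw [hE]; exact (hQ k).1
  · rw [← hl0]; exact e

/-- The complex `⋯ ⟶ 0 ⟶ X = X ⟶ 0 ⟶ ⋯` concentrated in degrees `0` and `-1`. -/
theorem exists_complex_of_identity {ℬ 𝒢 : ObjectProperty 𝒜} (h0 : ∀ Z, IsZero Z → 𝒢 Z) {X : 𝒜} (hX : 𝒢 X)
    (hV : leftExtOrthogonal ℬ X) :
    ∃ G : ChainComplex 𝒜 ℤ, G.Acyclic ∧ IsHomExact G ℬ ∧ (∀ n, 𝒢 (G.X n)) ∧
      Nonempty (X ≅ G.opcycles 0) := by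
  obtain ⟨O, hO⟩ := HasZeroObject.zero (C := 𝒜)
  let Z : ℤ → 𝒜 := fun n => match n with
    | .ofNat 0 => X
    | _ => O
  let E : ℤ → 𝒜 := fun n => match n with
    | .ofNat 0 => X
    | .negSucc 0 => X
    | _ => O
  have hz : HasSES O O O := HasSES.of_isZero_left hO _
  obtain ⟨K, hK, hHom, hE, e⟩ := exists_complex_of_hasSES (ℬ := ℬ) Z E (fun n => match n with
    | .ofNat 0 => HasSES.of_isZero_left hO X
    | .ofNat (k + 1) => hz
    | .negSucc 0 => HasSES.of_isZero_right hO X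
    | .negSucc (k + 1) => hz) (fun n => match n with
    | .ofNat 0 => hV
    | .ofNat (k + 1) => leftExtOrthogonal_of_isZero hO
    | .negSucc k => leftExtOrthogonal_of_isZero hO)
  refine ⟨K, hK, hHom, fun n => ?_, e⟩
  rw [hE]
  match n with
  | .ofNat 0 => exact hX
  | .ofNat (k + 1) => exact h0 _ hO
  | .negSucc 0 => exact hX
  | .negSucc (k + 1) => exact h0 _ hO

end Splice

/-! ### Sums of disk complexes and their Ext groups. -/

section Disks

variable {𝒜 : Type u'} [Category.{v} 𝒜] [Abelian 𝒜]

/-- A decomposition of `K` as the direct sum over `n` of the disk complexes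
`⋯ ⟶ 0 ⟶ M n = M n ⟶ 0 ⟶ ⋯` in degrees `n` and `n - 1`. -/
structure DiskDecomposition (K : ChainComplex 𝒜 ℤ) (M : ℤ → 𝒜) where
  fst (n : ℤ) : K.X n ⟶ M n
  snd (n : ℤ) : K.X n ⟶ M (n + 1)
  inl (n : ℤ) : M n ⟶ K.X n
  inr (n : ℤ) : M (n + 1) ⟶ K.X n
  inl_fst (n : ℤ) : inl n ≫ fst n = 𝟙 _
  inl_snd (n : ℤ) : inl n ≫ snd n = 0
  inr_fst (n : ℤ) : inr n ≫ fst n = 0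
  inr_snd (n : ℤ) : inr n ≫ snd n = 𝟙 _
  total (n : ℤ) : fst n ≫ inl n + snd n ≫ inr n = 𝟙 _
  d_eq (n : ℤ) : K.d (n + 1) n = fst (n + 1) ≫ inr n

namespace DiskDecomposition

attribute [simp] inl_fst inl_snd inr_fst inr_snd

lemma exists_complex (M : ℤ → 𝒜) :
    ∃ K : ChainComplex 𝒜 ℤ, Nonempty (DiskDecomposition K M) :=
  ⟨ChainComplex.of (fun n => M n ⊞ M (n + 1)) (fun n => biprod.fst ≫ biprod.inr)
    fun n => by simp, ⟨{
      fst := fun n => biprod.fst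
      snd := fun n => biprod.snd
      inl := fun n => biprod.inl
      inr := fun n => biprod.inr
      inl_fst := fun n => biprod.inl_fst
      inl_snd := fun n => biprod.inl_snd
      inr_fst := fun n => biprod.inr_fst
      inr_snd := fun n => biprod.inr_snd
      total := fun n => biprod.total
      d_eq := fun n => ChainComplex.of_d (fun n => M n ⊞ M (n + 1))
        (fun n => biprod.fst ≫ biprod.inr) n }⟩⟩

variable {K : ChainComplex 𝒜 ℤ} {M : ℤ → 𝒜} (D : DiskDecomposition K M)

include D

@[simp]
lemma inl_fst_assoc (n : ℤ) {T : 𝒜} (f : M n ⟶ T) : D.inl n ≫ D.fst n ≫ f = f := by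
  rw [← Category.assoc, D.inl_fst, Category.id_comp]

@[simp]
lemma inl_snd_assoc (n : ℤ) {T : 𝒜} (f : M (n + 1) ⟶ T) : D.inl n ≫ D.snd n ≫ f = 0 := by
  rw [← Category.assoc, D.inl_snd, zero_comp]

@[simp]
lemma inr_fst_assoc (n : ℤ) {T : 𝒜} (f : M n ⟶ T) : D.inr n ≫ D.fst n ≫ f = 0 := by
  rw [← Category.assoc, D.inr_fst, zero_comp]

@[simp]
lemma inr_snd_assoc (n : ℤ) {T : 𝒜} (f : M (n + 1) ⟶ T) : D.inr n ≫ D.snd n ≫ f = f := by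
  rw [← Category.assoc, D.inr_snd, Category.id_comp]

lemma hom_ext_X {n : ℤ} {T : 𝒜} {f g : K.X n ⟶ T} (h₁ : D.inl n ≫ f = D.inl n ≫ g)
    (h₂ : D.inr n ≫ f = D.inr n ≫ g) : f = g := by
  rw [← Category.id_comp f, ← Category.id_comp g, ← D.total n]
  simp [h₁, h₂]

lemma hom_ext_X' {n : ℤ} {T : 𝒜} {f g : T ⟶ K.X n} (h₁ : f ≫ D.fst n = g ≫ D.fst n)
    (h₂ : f ≫ D.snd n = g ≫ D.snd n) : f = g := by
  rw [← Category.comp_id f, ← Category.comp_id g, ← D.total n]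
  simp [reassoc_of% h₁, reassoc_of% h₂]

lemma inl_d (n : ℤ) : D.inl (n + 1) ≫ K.d (n + 1) n = D.inr n := by
  rw [D.d_eq, D.inl_fst_assoc]

lemma inl_d_assoc (n : ℤ) {T : 𝒜} (f : K.X n ⟶ T) :
    D.inl (n + 1) ≫ K.d (n + 1) n ≫ f = D.inr n ≫ f := by
  rw [← Category.assoc, D.inl_d]

lemma inr_d (n : ℤ) : D.inr (n + 1) ≫ K.d (n + 1) n = 0 := by
  rw [D.d_eq, D.inr_fst_assoc]

lemma inr_d_assoc (n : ℤ) {T : 𝒜} (f : K.X n ⟶ T) :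
    D.inr (n + 1) ≫ K.d (n + 1) n ≫ f = 0 := by
  rw [← Category.assoc, D.inr_d, zero_comp]

lemma shortExact (n : ℤ) :
    (ShortComplex.mk (D.inr n) (D.fst n) (D.inr_fst n)).ShortExact :=
  ShortComplex.Splitting.shortExact
    { r := D.snd n
      s := D.inl n
      f_r := D.inr_snd n
      s_g := D.inl_fst n
      id := (add_comm _ _).trans (D.total n) }

lemma acyclic : K.Acyclic := acyclic_of_splicing D.shortExact D.d_eq

/-- The opcycles of a sum of disks. -/
noncomputable def opcyclesIso (n : ℤ) : K.opcycles n ≅ M n :=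
  opcyclesIsoOfSplicing D.shortExact D.d_eq n

variable {Y : ChainComplex 𝒜 ℤ}

/-- Morphisms out of a sum of disks are families of morphisms `M n ⟶ Y_n`. -/
def desc (φ : ∀ n, M n ⟶ Y.X n) : K ⟶ Y :=
  ChainComplex.ofHom (fun n => D.fst n ≫ φ n + D.snd n ≫ φ (n + 1) ≫ Y.d (n + 1) n)
    fun n => D.hom_ext_X (by simp [D.inl_d_assoc]) (by simp [D.inr_d_assoc])

@[simp]
lemma inl_desc (φ : ∀ n, M n ⟶ Y.X n) (n : ℤ) : D.inl n ≫ (D.desc φ).f n = φ n := by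
  simp [desc]

@[simp]
lemma inr_desc (φ : ∀ n, M n ⟶ Y.X n) (n : ℤ) :
    D.inr n ≫ (D.desc φ).f n = φ (n + 1) ≫ Y.d (n + 1) n := by
  simp [desc]

@[simp]
lemma inl_desc_assoc (φ : ∀ n, M n ⟶ Y.X n) (n : ℤ) {T : 𝒜} (f : Y.X n ⟶ T) :
    D.inl n ≫ (D.desc φ).f n ≫ f = φ n ≫ f := by
  rw [← Category.assoc, D.inl_desc]

@[simp]
lemma inr_desc_assoc (φ : ∀ n, M n ⟶ Y.X n) (n : ℤ) {T : 𝒜} (f : Y.X n ⟶ T) :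
    D.inr n ≫ (D.desc φ).f n ≫ f = φ (n + 1) ≫ Y.d (n + 1) n ≫ f := by
  rw [← Category.assoc, D.inr_desc, Category.assoc]

/-- The `inr` components are forced, since `inr n` is `inl (n + 1)` followed by the differential. -/
lemma hom_ext {f g : K ⟶ Y} (h : ∀ n, D.inl n ≫ f.f n = D.inl n ≫ g.f n) : f = g := by
  ext n
  refine D.hom_ext_X (h n) ?_
  rw [← D.inl_d, Category.assoc, Category.assoc, ← f.comm, ← g.comm, reassoc_of% h (n + 1)]

lemma projective (hM : ∀ n, Projective (M n)) : Projective K where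
  factors {E X} f e he := by
    have he' (n : ℤ) : Epi (e.f n) := inferInstance
    refine ⟨D.desc fun n => Projective.factorThru (D.inl n ≫ f.f n) (e.f n), D.hom_ext fun n => ?_⟩
    simp

variable {K' : ChainComplex 𝒜 ℤ} {M' : ℤ → 𝒜} (D' : DiskDecomposition K' M')

lemma desc_fst (φ : ∀ n, M n ⟶ M' n) (n : ℤ) :
    (D.desc fun n => φ n ≫ D'.inl n).f n ≫ D'.fst n = D.fst n ≫ φ n :=
  D.hom_ext_X (by simp) (by simp [D'.inl_d_assoc])

lemma desc_snd (φ : ∀ n, M n ⟶ M' n) (n : ℤ) :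
    (D.desc fun n => φ n ≫ D'.inl n).f n ≫ D'.snd n = D.snd n ≫ φ (n + 1) :=
  D.hom_ext_X (by simp) (by simp [D'.inl_d_assoc])

lemma shortExact_desc {K'' : ChainComplex 𝒜 ℤ} {M'' : ℤ → 𝒜} (D'' : DiskDecomposition K'' M'')
    {i : ∀ n, M n ⟶ M' n} {p : ∀ n, M' n ⟶ M'' n} {w : ∀ n, i n ≫ p n = 0}
    (h : ∀ n, (ShortComplex.mk (i n) (p n) (w n)).ShortExact) :
    ∃ w', (ShortComplex.mk (D.desc fun n => i n ≫ D'.inl n)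
      (D'.desc fun n => p n ≫ D''.inl n) w').ShortExact := by
  refine ⟨D.hom_ext fun n => by simp [reassoc_of% w], ?_⟩
  apply HomologicalComplex.shortExact_of_degreewise_shortExact
  intro n
  have hi (n : ℤ) : Mono (i n) := (h n).mono_f
  have hp (n : ℤ) : Epi (p n) := (h n).epi_g
  have : Mono ((D.desc fun n => i n ≫ D'.inl n).f n) := by
    refine Preadditive.mono_of_cancel_zero _ fun g hg => D.hom_ext_X' ?_ ?_
    · rw [← cancel_mono (i n), Category.assoc, ← D.desc_fst D', reassoc_of% hg]
      simp
    · rw [← cancel_mono (i (n + 1)), Category.assoc, ← D.desc_snd D', reassoc_of% hg]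
      simp
  have : Epi ((D'.desc fun n => p n ≫ D''.inl n).f n) := by
    refine Preadditive.epi_of_cancel_zero _ fun g hg => D''.hom_ext_X ?_ ?_
    · have := D'.inl n ≫= hg
      rw [← cancel_epi (p n)]
      simpa using this
    · have := D'.inr n ≫= hg
      rw [← cancel_epi (p (n + 1))]
      simpa [D''.inl_d_assoc] using this
  refine shortExact_of_isCokernel ((D.desc fun n => i n ≫ D'.inl n).f n)
    ((D'.desc fun n => p n ≫ D''.inl n).f n) _ fun k hk => ?_
  obtain ⟨l₁, h₁⟩ := ShortExact.exists_desc (h n) (D'.inl n ≫ k) (by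
    have := D.inl n ≫= hk
    simpa using this)
  obtain ⟨l₂, h₂⟩ := ShortExact.exists_desc (h (n + 1)) (D'.inr n ≫ k) (by
    have := D.inr n ≫= hk
    simpa [D'.inl_d_assoc] using this)
  exact ⟨D''.fst n ≫ l₁ + D''.snd n ≫ l₂,
    D'.hom_ext_X (by simp [h₁]) (by simp [D''.inl_d_assoc, h₂])⟩

/-- The kernel of this presentation is again a sum of disks, so inductions on the Ext degree can
continue with it. -/
lemma exists_projective_presentation [EnoughProjectives 𝒜] :
    ∃ (L N : ChainComplex 𝒜 ℤ) (DL : DiskDecomposition L fun n => Projective.over (M n))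
      (DN : DiskDecomposition N fun n => kernel (Projective.π (M n))),
      Projective L ∧
      (∀ n, (ShortComplex.mk (kernel.ι (Projective.π (M n))) (Projective.π (M n))
        (kernel.condition _)).ShortExact) ∧
      ∃ w, (ShortComplex.mk (DN.desc fun n => kernel.ι (Projective.π (M n)) ≫ DL.inl n)
        (DL.desc fun n => Projective.π (M n) ≫ D.inl n) w).ShortExact := by
  obtain ⟨L, ⟨DL⟩⟩ := exists_complex fun n => Projective.over (M n)
  obtain ⟨N, ⟨DN⟩⟩ := exists_complex fun n => kernel (Projective.π (M n))
  have hs (n : ℤ) : (ShortComplex.mk (kernel.ι (Projective.π (M n))) (Projective.π (M n))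
      (kernel.condition _)).ShortExact :=
    { exact := ShortComplex.exact_of_f_is_kernel _ (kernelIsKernel _) }
  exact ⟨L, N, DL, DN, DL.projective fun n => inferInstance, hs, DN.shortExact_desc DL D hs⟩

omit D in
/-- `Ext^i(K, H) = 0` for a sum of disks `K` as soon as `Ext^i(M n, H_n) = 0` for all `n`. -/
theorem ext_subsingleton [EnoughProjectives 𝒜] [HasExt.{w} 𝒜] [HasExt.{w'} (ChainComplex 𝒜 ℤ)]
    {H : ChainComplex 𝒜 ℤ} (i : ℕ) {K : ChainComplex 𝒜 ℤ} {M : ℤ → 𝒜}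
    (D : DiskDecomposition K M)
    (hM : ∀ n (i : ℕ), Subsingleton (Ext (M n) (H.X n) (i + 1))) :
    Subsingleton (Ext K H (i + 1)) := by
  induction i generalizing K M with
  | zero =>
    obtain ⟨L, N, DL, DN, _, hs, _, hs'⟩ := D.exists_projective_presentation
    refine ext_one_subsingleton_of_extend hs' (Ext.subsingleton_of_projective _ _ _) fun f => ?_
    -- A chain map out of a sum of disks is a free choice of maps on the `M n`, so extending it is a
    -- separate problem in each degree.
    choose g hg using fun n => exists_extend_of_ext_one_subsingleton (hs n) (hM n 0)
      (DN.inl n ≫ f.f n)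
    exact ⟨DL.desc g, DN.hom_ext fun n => by simp [hg]⟩
  | succ i ih =>
    obtain ⟨L, N, DL, DN, _, hs, _, hs'⟩ := D.exists_projective_presentation
    -- The kernels of `Projective.π (M n)` inherit the vanishing hypothesis from `M n` by dimension
    -- shifting.
    exact HasSES.ext_right ⟨_, _, _, hs'⟩ (i + 1) (ih DN fun n k => HasSES.ext_left ⟨_, _, _, hs n⟩
      (k + 1) (Ext.subsingleton_of_projective _ _ _) (hM n (k + 1)))
      (Ext.subsingleton_of_projective _ _ _)

end DiskDecomposition

/-- An acyclic complex whose cycles are split is a sum of disks. -/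
lemma nonempty_diskDecomposition_of_acyclic {K : ChainComplex 𝒜 ℤ} (hK : K.Acyclic)
    (hs : ∀ n, ∃ r : K.X n ⟶ K.opcycles (n + 1), K.fromOpcycles (n + 1) n ≫ r = 𝟙 _) :
    Nonempty (DiskDecomposition K fun n => K.opcycles n) := by
  choose r hr using hs
  have h (n : ℤ) := shortExact_opcycles K (c := ComplexShape.down ℤ) (i := n + 1) (j := n)
    rfl (hK (n + 1))
  let σ (n : ℤ) := ShortComplex.Splitting.ofExactOfRetraction _ (h n).exact (r n) (hr n)
    (h n).epi_g
  exact ⟨{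
    fst := fun n => K.pOpcycles n
    snd := r
    inl := fun n => (σ n).s
    inr := fun n => K.fromOpcycles (n + 1) n
    inl_fst := fun n => (σ n).s_g
    inl_snd := fun n => (σ n).s_r
    inr_fst := fun n => by
      rw [← cancel_epi (K.pOpcycles (n + 1)), K.p_fromOpcycles_assoc, K.d_pOpcycles, comp_zero]
    inr_snd := hr
    total := fun n => (add_comm _ _).trans (σ n).id
    d_eq := fun n => (K.p_fromOpcycles _ _).symm }⟩

/-- In an acyclic complex, opcycles agree with the cycles one degree below. -/
lemma nonempty_opcycles_iso_cycles {K : ChainComplex 𝒜 ℤ} (hK : K.Acyclic) {i j : ℤ}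
    (hij : j + 1 = i) : Nonempty (K.opcycles i ≅ K.cycles j) := by
  have := (shortExact_opcycles K (c := ComplexShape.down ℤ) hij (hK i)).mono_f
  have : Mono (K.opcyclesToCycles i j) :=
    mono_of_mono_fac (K.opcyclesToCycles_iCycles i j)
  have : Epi (K.opcyclesToCycles i j) := by
    have : Epi (K.toCycles i j) := by
      obtain rfl : (ComplexShape.down ℤ).prev j = i := by simpa using hij
      exact (hK j).epi_toCycles
    exact epi_of_epi_fac (K.pOpcycles_opcyclesToCycles i j)
  have := isIso_of_mono_of_epi (K.opcyclesToCycles i j)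
  exact ⟨asIso (K.opcyclesToCycles i j)⟩

end Disks

/-! ### Tensor evaluation and extension of maps. -/

section TensorHom

variable {R : Type*} [CommRing R]
  {L₂ L₁ L₀ K N F P : Type*} [AddCommGroup L₂] [Module R L₂] [AddCommGroup L₁] [Module R L₁]
  [AddCommGroup L₀] [Module R L₀] [AddCommGroup K] [Module R K] [AddCommGroup N] [Module R N]
  [AddCommGroup F] [Module R F] [AddCommGroup P] [Module R P]

lemma rTensorHomToHomRTensor_rTensor_lcomp (f : L₁ →ₗ[R] L₀) (t : (L₀ →ₗ[R] N) ⊗[R] F) :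
    TensorProduct.rTensorHomToHomRTensor (.id R) L₁ N F ((LinearMap.lcomp R N f).rTensor F t) =
      TensorProduct.rTensorHomToHomRTensor (.id R) L₀ N F t ∘ₗ f := by
  induction t with
  | zero => simp
  | add x y hx hy => simp only [map_add, hx, hy, LinearMap.add_comp]
  | tmul φ y => ext; simp

/-- For `K` presented by finitely generated projectives and `F` flat, the tensor evaluation
`Hom(K, N) ⊗ F → Hom(K, N ⊗ F)` is surjective. -/
lemma rTensorHomToHomRTensor_surjective [Module.Finite R L₂] [Module.Projective R L₂]
    [Module.Finite R L₁] [Module.Projective R L₁] [Module.Flat R F]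
    {d : L₂ →ₗ[R] L₁} {q : L₁ →ₗ[R] K} (hdq : Function.Exact d q) (hq : Function.Surjective q) :
    Function.Surjective (TensorProduct.rTensorHomToHomRTensor (.id R) K N F) := by
  intro g
  obtain ⟨t, ht⟩ := (rTensorHomEquivHomRTensor R L₁ N F).surjective (g ∘ₗ q)
  rw [rTensorHomEquivHomRTensor_apply] at ht
  -- Evaluation is bijective at `L₁` and `L₂`, so `t` is killed by `d`; flatness of `F` then lifts
  -- it to `Hom(K, N) ⊗ F`.
  have h₀ : (LinearMap.lcomp R N d).rTensor F t = 0 := by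
    apply (rTensorHomEquivHomRTensor R L₂ N F).injective
    rw [rTensorHomEquivHomRTensor_apply, rTensorHomToHomRTensor_rTensor_lcomp, ht, map_zero,
      LinearMap.comp_assoc, hdq.linearMap_comp_eq_zero, LinearMap.comp_zero]
  have hex : Function.Exact (LinearMap.lcomp R N q) (LinearMap.lcomp R N d) :=
    LinearMap.exact_lcomp_of_exact_of_surjective N hdq hq
  obtain ⟨t', rfl⟩ := (Module.Flat.rTensor_exact F hex t).1 h₀
  refine ⟨t', ?_⟩
  rw [rTensorHomToHomRTensor_rTensor_lcomp] at ht
  exact (LinearMap.cancel_right hq).1 ht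

lemma exists_extend_to_tensor (j : K →ₗ[R] L₀)
    (hF : Function.Surjective (TensorProduct.rTensorHomToHomRTensor (.id R) K N F))
    (hext : Function.Surjective (LinearMap.lcomp R N j)) :
    Function.Surjective (LinearMap.lcomp R (N ⊗[R] F) j) := by
  intro g
  obtain ⟨t, rfl⟩ := hF g
  obtain ⟨t', rfl⟩ := LinearMap.rTensor_surjective F hext t
  exact ⟨_, (rTensorHomToHomRTensor_rTensor_lcomp j t').symm⟩

/-- By adjunction a map `K ⊗ P → N` is a map `P → Hom(K, N)`, which lifts through the surjection
from `Hom(L₀, N)`. -/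
lemma exists_extend_rTensor [Module.Projective R P] (j : K →ₗ[R] L₀)
    (hext : Function.Surjective (LinearMap.lcomp R N j)) :
    Function.Surjective (LinearMap.lcomp R N (j.rTensor P)) := by
  intro u
  obtain ⟨v, hv⟩ := Module.projective_lifting_property (LinearMap.lcomp R N j)
    (TensorProduct.curry u).flip hext
  refine ⟨TensorProduct.lift v.flip, TensorProduct.ext' fun k p => ?_⟩
  have := LinearMap.congr_fun (LinearMap.congr_fun hv p) k
  simpa using this

end TensorHom

/-! ### Ext vanishing between `C`-projective and `C`-flat modules. -/

section Modules

variable {R : Type u} [CommRing R]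

lemma shortExact_rTensor {S : ShortComplex (ModuleCat.{u} R)} (hS : S.ShortExact)
    (P : Type u) [AddCommGroup P] [Module R P] [Module.Flat R P] :
    ∃ w, (ShortComplex.mk (ModuleCat.ofHom (S.f.hom.rTensor P))
      (ModuleCat.ofHom (S.g.hom.rTensor P)) w).ShortExact := by
  have hex := (ShortComplex.ShortExact.moduleCat_exact_iff_function_exact S).1 hS.exact
  have h := Module.Flat.rTensor_exact P hex
  exact ⟨ModuleCat.hom_ext h.linearMap_comp_eq_zero, ModuleCat.shortComplex_shortExact _ h
    (Module.Flat.rTensor_preserves_injective_linearMap _ hS.moduleCat_injective_f)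
    (LinearMap.rTensor_surjective _ hS.moduleCat_surjective_g)⟩

lemma opcycles_zero_iso {C : ModuleCat.{u} R} (P : ProjectiveResolution C) :
    Nonempty (P.complex.opcycles 0 ≅ C) :=
  ⟨(P.complex.opcyclesIsCokernel 1 0 (by simp)).coconePointUniqueUpToIso
    P.isColimitCokernelCofork⟩

/-- `Ext^i(C ⊗ P, C ⊗ F) = 0` for `i ≥ 1`, `P` projective and `F` flat. -/
theorem IsSemidualizing.leftExtOrthogonal_tensor {C : ModuleCat.{u} R} (hC : IsSemidualizing C)
    (P : Type u) [AddCommGroup P] [Module R P] [Module.Projective R P] :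
    leftExtOrthogonal (cFlatModules C) (ModuleCat.of R (C ⊗[R] P)) := by
  obtain ⟨L, hL⟩ := hC.exists_finite_resolution
  obtain ⟨e⟩ := opcycles_zero_iso L
  have hs (n : ℕ) := shortExact_opcycles L.complex (c := ComplexShape.down ℕ) (i := n + 1)
    (j := n) rfl (L.complex_exactAt_succ n)
  have hproj (n : ℕ) : Module.Projective R (L.complex.X n) :=
    (L.complex.X n).projective_of_module_projective
  -- Every syzygy of `C` inherits `Ext^i(-, C) = 0` for `i ≥ 1`, so maps from a syzygy to `C` extend
  -- to the next term of the resolution.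
  have hK (n : ℕ) : leftExtOrthogonal (fun X => X = C) (L.complex.opcycles n) := by
    induction n with
    | zero =>
      refine leftExtOrthogonal_of_iso e.symm ?_
      rintro _ rfl i
      exact hC.ext_vanishing (i + 1) (by lia)
    | succ n ih =>
      exact HasSES.leftExtOrthogonal_left ⟨_, _, _, hs n⟩
        (leftExtOrthogonal_of_projective _) ih
  choose w ht using fun n => shortExact_rTensor (hs n) P
  -- `L ⊗ P` is a projective resolution of `C ⊗ P`, so it remains to extend maps to `C ⊗ F` from its
  -- syzygies: the target is first enlarged from `C` to `C ⊗ F`, then the source is tensored with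
  -- `P`.
  refine leftExtOrthogonal_of_iso (LinearEquiv.toModuleIso
    (e.toLinearEquiv.rTensor P)) (leftExtOrthogonal_of_syzygies
    (fun n => ModuleCat.of R (L.complex.opcycles n ⊗[R] P))
    (fun n => ModuleCat.of R (L.complex.X n ⊗[R] P)) (fun n => n + 1) _ _ w ht
    (fun n => leftExtOrthogonal_of_projective _) ?_ 0)
  rintro n H ⟨F, hF, ⟨eH⟩⟩ f
  have hd : Function.Exact (L.complex.d (n + 2) (n + 1)).hom
      (L.complex.pOpcycles (n + 1)).hom :=
    (ShortComplex.ShortExact.moduleCat_exact_iff_function_exact _).1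
      (ShortComplex.exact_of_g_is_cokernel (ShortComplex.mk _ _ (L.complex.d_pOpcycles _ _))
        (L.complex.opcyclesIsCokernel (n + 2) (n + 1) (by simp)))
  have hq : Function.Surjective (L.complex.pOpcycles (n + 1)).hom :=
    (ModuleCat.epi_iff_surjective _).1 inferInstance
  have := hL (n + 1)
  have := hL (n + 2)
  have hsurj := rTensorHomToHomRTensor_surjective (N := C) (F := F) hd hq
  have hext : Function.Surjective
      (LinearMap.lcomp R C (L.complex.fromOpcycles (n + 1) n).hom) := by
    intro φ
    obtain ⟨g, hg⟩ := exists_extend_of_ext_one_subsingleton (hs n) (hK n C rfl 0)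
      (ModuleCat.ofHom φ)
    exact ⟨g.hom, congrArg ModuleCat.Hom.hom hg⟩
  obtain ⟨g, hg⟩ := exists_extend_rTensor (P := P) _
    (exists_extend_to_tensor _ hsurj hext) (eH.toLinearMap ∘ₗ f.hom)
  refine ⟨ModuleCat.ofHom (eH.symm.toLinearMap ∘ₗ g), ?_⟩
  exact ModuleCat.hom_ext (LinearMap.ext fun x =>
    (eH.symm_apply_eq).2 (LinearMap.congr_fun hg x))

end Modules

/-! ### The classes `tilde 𝒳` and the description of `D_C`-projective complexes. -/

section Tilde

variable {R : Type u} [CommRing R]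

instance : (projectiveModules R).IsClosedUnderIsomorphisms where
  of_iso e h := by
    dsimp only [projectiveModules] at h ⊢
    exact Module.Projective.of_equiv e.toLinearEquiv

instance (C : ModuleCat.{u} R) : (cProjectiveModules C).IsClosedUnderIsomorphisms where
  of_iso e := fun ⟨P, hP, ⟨f⟩⟩ => ⟨P, hP, ⟨e.symm.toLinearEquiv.trans f⟩⟩

instance (C : ModuleCat.{u} R) : (cFlatModules C).IsClosedUnderIsomorphisms where
  of_iso e := fun ⟨F, hF, ⟨f⟩⟩ => ⟨F, hF, ⟨e.symm.toLinearEquiv.trans f⟩⟩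

lemma cProjectiveModules_le_cFlatModules (C : ModuleCat.{u} R) :
    cProjectiveModules C ≤ cFlatModules C :=
  fun _ ⟨P, _, e⟩ => ⟨P, inferInstance, e⟩

lemma tilde_monotone {𝒳 𝒴 : ObjectProperty (ModuleCat.{u} R)} (h : 𝒳 ≤ 𝒴) : tilde 𝒳 ≤ tilde 𝒴 :=
  fun _ hX => ⟨hX.1, fun i => h _ (hX.2 i)⟩

variable {𝒳 : ObjectProperty (ModuleCat.{u} R)}

lemma tilde_iff_opcycles [𝒳.IsClosedUnderIsomorphisms] {K : Ch R} (hK : K.Acyclic) :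
    tilde 𝒳 K ↔ ∀ n, 𝒳 (K.opcycles n) := by
  refine ⟨fun h n => ?_, fun h => ⟨hK, fun n => ?_⟩⟩
  · obtain ⟨e⟩ := nonempty_opcycles_iso_cycles hK (sub_add_cancel n 1)
    exact 𝒳.prop_of_iso e.symm (h.2 _)
  · obtain ⟨e⟩ := nonempty_opcycles_iso_cycles hK (i := n + 1) rfl
    exact 𝒳.prop_of_iso e (h _)

lemma tilde_of_isZero [𝒳.IsClosedUnderIsomorphisms] (h𝒳 : ∀ Z, IsZero Z → 𝒳 Z) {K : Ch R}
    (hK : IsZero K) : tilde 𝒳 K := by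
  have hX (n : ℤ) : IsZero (K.X n) := (HomologicalComplex.eval _ _ n).map_isZero hK
  exact ⟨fun n => HomologicalComplex.ExactAt.of_isZero (hX n),
    fun n => h𝒳 _ ((hX n).of_mono (K.iCycles n))⟩

instance (n : ℤ) : (HomologicalComplex.cyclesFunctor (ModuleCat.{u} R)
    (ComplexShape.down ℤ) n).Additive where
  map_add {K L f g} := by
    change HomologicalComplex.cyclesMap (f + g) n =
      HomologicalComplex.cyclesMap f n + HomologicalComplex.cyclesMap g n
    rw [← cancel_mono (L.iCycles n)]
    simp

lemma tilde_biprod [𝒳.IsClosedUnderIsomorphisms] (h𝒳 : ∀ A B, 𝒳 A → 𝒳 B → 𝒳 (A ⊞ B))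
    {K L : Ch R} (hK : tilde 𝒳 K) (hL : tilde 𝒳 L) : tilde 𝒳 (K ⊞ L) := by
  have (n : ℤ) := preservesBinaryBiproducts_of_preservesBiproducts
    (HomologicalComplex.homologyFunctor (ModuleCat.{u} R) (ComplexShape.down ℤ) n)
  have (n : ℤ) := preservesBinaryBiproducts_of_preservesBiproducts
    (HomologicalComplex.cyclesFunctor (ModuleCat.{u} R) (ComplexShape.down ℤ) n)
  refine ⟨fun n => ?_, fun n => ?_⟩
  · rw [HomologicalComplex.exactAt_iff_isZero_homology]
    refine IsZero.of_iso ?_ ((HomologicalComplex.homologyFunctor (ModuleCat.{u} R)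
      (ComplexShape.down ℤ) n).mapBiprod K L)
    exact (biprod_isZero_iff _ _).2 ⟨(hK.1 n).isZero_homology, (hL.1 n).isZero_homology⟩
  · exact 𝒳.prop_of_iso ((HomologicalComplex.cyclesFunctor (ModuleCat.{u} R)
      (ComplexShape.down ℤ) n).mapBiprod K L).symm (h𝒳 _ _ (hK.2 n) (hL.2 n))

lemma cProjectiveModules_biprod {C A B : ModuleCat.{u} R} (hA : cProjectiveModules C A)
    (hB : cProjectiveModules C B) : cProjectiveModules C (A ⊞ B) := by
  obtain ⟨P, hP, ⟨e⟩⟩ := hA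
  obtain ⟨Q, hQ, ⟨f⟩⟩ := hB
  exact ⟨ModuleCat.of R (P × Q), inferInstanceAs (Module.Projective R (P × Q)),
    ⟨((ModuleCat.biprodIsoProd A B).toLinearEquiv.trans (e.prodCongr f)).trans
      (TensorProduct.prodRight R R C P Q).symm⟩⟩

lemma cProjectiveModules_of_isZero {C Z : ModuleCat.{u} R} (hZ : IsZero Z) :
    cProjectiveModules C Z := by
  have : Subsingleton Z := ModuleCat.subsingleton_of_isZero hZ
  exact ⟨ModuleCat.of R PUnit.{u + 1}, inferInstanceAs (Module.Projective R PUnit.{u + 1}),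
    ⟨{ (0 : Z →ₗ[R] C ⊗[R] PUnit.{u + 1}) with
        invFun := 0
        left_inv := fun _ => Subsingleton.elim _ _
        right_inv := fun _ => Subsingleton.elim _ _ }⟩⟩

lemma nonempty_diskDecomposition_of_tilde [𝒳.IsClosedUnderIsomorphisms]
    (h𝒳 : ∀ A B, 𝒳 A → 𝒳 B → Subsingleton (Ext A B 1)) {K : Ch R} (hK : tilde 𝒳 K) :
    Nonempty (DiskDecomposition K fun n => K.opcycles n) := by
  have h𝒳' := (tilde_iff_opcycles hK.1).1 hK
  refine nonempty_diskDecomposition_of_acyclic hK.1 fun n => ?_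
  exact exists_extend_of_ext_one_subsingleton
    (shortExact_opcycles K (c := ComplexShape.down ℤ) (i := n + 1) (j := n) rfl (hK.1 (n + 1)))
    (h𝒳 _ _ (h𝒳' n) (h𝒳' (n + 1))) (𝟙 _)

/-- The sum of the disks on projectives mapping onto each `X.X n` maps onto `X`. -/
lemma exists_hasSES_tilde_projectiveModules (X : Ch R) :
    ∃ P K : Ch R, tilde (projectiveModules R) P ∧ HasSES K P X := by
  obtain ⟨P, ⟨D⟩⟩ := DiskDecomposition.exists_complex fun n => Projective.over (X.X n)
  have : Epi (D.desc fun n => Projective.π (X.X n)) := by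
    refine HomologicalComplex.epi_of_epi_f _ fun n => ?_
    exact epi_of_epi_fac (D.inl_desc (fun n => Projective.π (X.X n)) n)
  refine ⟨P, _, (tilde_iff_opcycles D.acyclic).2 fun n => ?_,
    HasSES.of_epi (D.desc fun n => Projective.π (X.X n))⟩
  exact (projectiveModules R).prop_of_iso (D.opcyclesIso n).symm
    (Projective.over (X.X n)).projective_of_module_projective

variable [HasExt.{w} (Ch R)]

lemma leftExtOrthogonal_of_tilde_projectiveModules (ℬ : ObjectProperty (Ch R)) :
    tilde (projectiveModules R) ≤ leftExtOrthogonal ℬ := by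
  intro P hP
  have hproj {M : ModuleCat.{u} R} (hM : projectiveModules R M) : Projective M := by
    have : Module.Projective R M := hM
    infer_instance
  obtain ⟨D⟩ := nonempty_diskDecomposition_of_tilde (fun A B hA _ => by
    have := hproj hA
    exact Ext.subsingleton_of_projective _ _ _) hP
  have : Projective P := D.projective fun n => hproj ((tilde_iff_opcycles hP.1).1 hP n)
  exact leftExtOrthogonal_of_projective P

variable {C : ModuleCat.{u} R} (hC : IsSemidualizing C)

include hC

omit [HasExt.{w} (Ch R)] in
lemma IsSemidualizing.cProjectiveModules_le :
    cProjectiveModules C ≤ leftExtOrthogonal (cFlatModules C) := by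
  rintro M ⟨P, _, ⟨e⟩⟩
  exact leftExtOrthogonal_of_iso (LinearEquiv.toModuleIso e.symm) (hC.leftExtOrthogonal_tensor P)

/-- `Q` is a sum of disks on `C`-projective modules, and each `H.X n` is an extension of `C`-flat
modules, so the vanishing for modules applies in every degree. -/
lemma IsSemidualizing.tilde_cProjectiveModules_le :
    tilde (cProjectiveModules C) ≤ leftExtOrthogonal (tilde (cFlatModules C)) := by
  intro Q hQ H hH i
  obtain ⟨D⟩ := nonempty_diskDecomposition_of_tilde (fun A B hA hB =>
    hC.cProjectiveModules_le A hA B (cProjectiveModules_le_cFlatModules C _ hB) 0) hQ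
  refine DiskDecomposition.ext_subsingleton i D fun n i => ?_
  have hM := hC.cProjectiveModules_le _ ((tilde_iff_opcycles hQ.1).1 hQ n)
  have hH' := (tilde_iff_opcycles hH.1).1 hH
  exact HasSES.ext_target ⟨_, _, _, shortExact_opcycles H (c := ComplexShape.down ℤ)
    (i := n + 1) (j := n) rfl (hH.1 (n + 1))⟩ (i + 1) (hM _ (hH' (n + 1)) i) (hM _ (hH' n) i)

/-- `D_C`-projective complexes are the complexes that are `Ext`-orthogonal to all `C`-flat
complexes and have a proper coresolution by `C`-projective complexes. -/
theorem isDCProjective_iff_coresolved (X : Ch R) :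
    IsDCProjective C X ↔
      coresolved (leftExtOrthogonal (tilde (cFlatModules C))) (tilde (cProjectiveModules C)) X := by
  constructor
  · rintro ⟨E, hE, hHom, hP, hQ, ⟨e⟩⟩
    refine coresolved_of_acyclic E hE hHom (fun n => ?_) hQ
      (e ≪≫ (opcyclesIsoImage E hE (by simp)).symm)
    rcases le_or_gt 0 n with h | h
    · exact leftExtOrthogonal_of_tilde_projectiveModules _ _ (hP n h)
    · exact hC.tilde_cProjectiveModules_le _ (hQ n h)
  · intro hX
    obtain ⟨E, hE, hHom, hP, hQ, ⟨e⟩⟩ := exists_complex_of_coresolved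
      (leftExtOrthogonal_of_tilde_projectiveModules _) exists_hasSES_tilde_projectiveModules hX
    exact ⟨E, hE, hHom, hP, hQ, ⟨e ≪≫ opcyclesIsoImage E hE (by simp)⟩⟩

end Tilde

end DingComplex

/-! ### The stability theorem. -/

theorem theorem2p16 {R : Type u} [CommRing R] (C : ModuleCat.{u} R)
    (hC : DingComplex.IsSemidualizing C) (X : DingComplex.Ch R) :
    DingComplex.IsDCProjective C X ↔
      ∃ G : ChainComplex (DingComplex.Ch R) ℤ,
        G.Acyclic ∧
        DingComplex.IsHomExact G (DingComplex.tilde (DingComplex.cFlatModules C)) ∧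
        (∀ i : ℤ, DingComplex.IsDCProjective C (G.X i)) ∧
        Nonempty (X ≅ Limits.cokernel (G.d 1 0)) := by
  open DingComplex in
  -- Ext groups of complexes serve only as a tool here; the statement does not involve them.
  have := HasExt.standard (Ch R)
  have h0 (Z : Ch R) (hZ : Limits.IsZero Z) : tilde (cProjectiveModules C) Z :=
    tilde_of_isZero (fun _ => cProjectiveModules_of_isZero) hZ
  simp only [isDCProjective_iff_coresolved hC]
  constructor
  · intro hX
    obtain ⟨G, hG, hHom, hGX, ⟨e⟩⟩ := exists_complex_of_identity
      (fun Z hZ => coresolved_of_isZero h0 hZ) hX hX.mem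
    exact ⟨G, hG, hHom, hGX, ⟨e ≪≫ opcyclesIsoCokernel G (by simp)⟩⟩
  · rintro ⟨G, hG, hHom, hGX, ⟨e⟩⟩
    -- `G` coresolves `X` by objects that are themselves coresolved, and each of its terms is
    -- orthogonal to the `C`-flat complexes.
    exact coresolved_coresolved_le (tilde_monotone (cProjectiveModules_le_cFlatModules C)) h0
      (fun _ _ => tilde_biprod fun _ _ => cProjectiveModules_biprod) _
      (coresolved_of_acyclic G hG hHom (fun n => (hGX n).mem) (fun n _ => hGX n)
        (e ≪≫ (opcyclesIsoCokernel G (by simp)).symm))
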